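/- **Proposition 4 (sample complexity of max-slicing).** Let $d\ge 1$, $n\ge 1$, let $P$ be a Borel probability measure on $\mathbb R^d$ with $\operatorname{diam}(\operatorname{supp}P)\le D<\infty$, let $X_1,\dots,X_n$ be i.i.d. with law $P$, and let $P_n=\frac1n\sum_{i=1}^n\delta_{X_i}$. For $\Delta:\mathcal P(\mathbb R)\times\mathcal P(\mathbb R)\to[0,\infty]$ put $$\mathbf{MS}\Delta(\mu,\nu)=\sup_{\theta\in\mathbb R^d,\ \|\theta\|_2=1}\Delta\big((P_\theta)_\#\mu,(P_\theta)_\#\nu\big),\qquad P_\theta(x)=\langle\theta,x\rangle,$$ and write $F_\mu$ for the distribution function of a law $\mu$ on $\mathbb R$. ($\mathbb E$ is read as outer expectation if $\mathbf{MS}\Delta(P_n,P)$ is not measurable.) (i) Let $\alpha\in(0,1]$, $\beta\ge 0$, $L>0$ be such that $$\Delta(\mu,\nu)\le L\,D^\beta\,\|F_\mu-F_\nu\|_\infty^\alpha$$ for all laws $\mu,\nu$ on $\mathbb R$ supported on a common interval of length at most $D$. Then there is a constant $C>0$, depending only on $L$ and $\alpha$, such that $$\mathbb E\,\mathbf{MS}\Delta(P_n,P)\le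 L D^\beta\Big(\sqrt{\tfrac{32(d+1)\log(n+1)}{n}}+4\sqrt{\tfrac{32\pi}{n}}\Big)^{\alpha}\le C D^\beta\Big(\sqrt{\tfrac{d\log(n+1)}{n}}\Big)^{\alpha},$$ and, for $n\ge 2$, $$\mathbb E\,\mathbf{MS}\Delta(P_n,P)\le C\,D^\beta\Big(\frac{d\log n}{n}\Big)^{\alpha/2}.$$ (ii) There are an absolute constant $C>0$ and, for each $p>1$, a constant $C_p>0$ depending only on $p$, such that for $n\ge 2$ $$\mathbb E\,\mathbf{MSW}_1(P_n,P)\le C D\sqrt{\tfrac{d\log n}{n}},\qquad \mathbb E\,\mathbf{MSW}_p(P_n,P)\le C_p D\Big(\tfrac{d\log n}{n}\Big)^{1/(2p)},\qquad \mathbb E\,\mathbf{MSC}_2(P_n,P)\le C\sqrt D\sqrt{\tfrac{d\log n}{n}}.$$ Here $\mathbf{MSW}_p$ is $\mathbf{MS}\Delta$ for $\Delta=\mathbf W_p$, the $p$-Wasserstein distance on $\mathbb R$, and $\mathbf{MSC}_2$ is $\mathbf{MS}\Delta$ for $\Delta(\mu,\nu)=\|F_\mu-F_\nu\|_{L^2(\mathbb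 R)}$. -/

import Mathlib

open MeasureTheory ProbabilityTheory
open scoped ENNReal NNReal

universe u

namespace MaxSlicing

noncomputable section

/-- The law of `⟨θ, x⟩` when `x` has law `μ`: the pushforward of `μ` by the projection onto `θ`. -/
def project {d : ℕ} (θ : EuclideanSpace ℝ (Fin d))
    (μ : ProbabilityMeasure (EuclideanSpace ℝ (Fin d))) : ProbabilityMeasure ℝ :=
  μ.map (f := fun x => inner ℝ θ x) (by fun_prop)

/-- The max-sliced divergence: the supremum over the unit sphere of a base divergence `Δ` between
the one-dimensional projections. -/
def maxSliced (Δ : ProbabilityMeasure ℝ → ProbabilityMeasure ℝ → ℝ≥0∞) {d : ℕ}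
    (μ ν : ProbabilityMeasure (EuclideanSpace ℝ (Fin d))) : ℝ≥0∞ :=
  ⨆ θ : Metric.sphere (0 : EuclideanSpace ℝ (Fin d)) 1, Δ (project θ μ) (project θ ν)

/-- The empirical law `(1/n) ∑ δ_{x i}` of `n ≥ 1` points. -/
def empirical {E : Type*} [MeasurableSpace E] {n : ℕ} [NeZero n] (x : Fin n → E) :
    ProbabilityMeasure E :=
  ⟨(n : ℝ≥0∞)⁻¹ • ∑ i, Measure.dirac (x i), ⟨by
    simp [ENNReal.inv_mul_cancel (Nat.cast_ne_zero.2 (NeZero.ne n)) (ENNReal.natCast_ne_top n)]⟩⟩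

/-- The uniform distance `‖F_μ - F_ν‖_∞` of the distribution functions of two laws on `ℝ`. -/
def cdfDist (μ ν : ProbabilityMeasure ℝ) : ℝ :=
  ⨆ t : ℝ, |cdf (μ : Measure ℝ) t - cdf (ν : Measure ℝ) t|

/-- CDF dominance at scale `D`: `Δ(μ, ν) ≤ L D^β ‖F_μ - F_ν‖_∞^α` for all laws `μ, ν` on `ℝ` that
are supported on a common interval of length at most `D`. -/
def CDFDominated (Δ : ProbabilityMeasure ℝ → ProbabilityMeasure ℝ → ℝ≥0∞) (D L β α : ℝ) : Prop :=
  ∀ (μ ν : ProbabilityMeasure ℝ) (a b : ℝ), b - a ≤ D →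
    (μ : Measure ℝ) (Set.Icc a b)ᶜ = 0 → (ν : Measure ℝ) (Set.Icc a b)ᶜ = 0 →
      Δ μ ν ≤ ENNReal.ofReal (L * D ^ β * cdfDist μ ν ^ α)

/-- `diam (supp P) ≤ D`. -/
def SuppDiamLE {d : ℕ} (P : ProbabilityMeasure (EuclideanSpace ℝ (Fin d))) (D : ℝ) : Prop :=
  Metric.ediam (P : Measure (EuclideanSpace ℝ (Fin d))).support ≤ ENNReal.ofReal D

/-- `X 0, …, X (n - 1)` are independent and identically distributed with law `P`. -/
structure IsIIDSample {Ω E : Type*} [MeasurableSpace Ω] [MeasurableSpace E] {n : ℕ}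
    (X : Fin n → Ω → E) (P : ProbabilityMeasure E) (ρ : Measure Ω) : Prop where
  law : ∀ i, HasLaw (X i) (P : Measure E) ρ
  indep : iIndepFun X ρ

/-- Expectation of a nonnegative random quantity, defined without any measurability requirement as
the outer expectation: the infimum of the integrals of measurable majorants. It is the usual
expectation when `f` is measurable, and it is never smaller than `∫⁻ ω, f ω ∂ρ`. -/
def expect {Ω : Type*} [MeasurableSpace Ω] (ρ : Measure Ω) (f : Ω → ℝ≥0∞) : ℝ≥0∞ :=
  ⨅ (g : Ω → ℝ≥0∞) (_ : Measurable g) (_ : f ≤ g), ∫⁻ ω, g ω ∂ρ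

theorem expect_eq_lintegral {Ω : Type*} [MeasurableSpace Ω] (ρ : Measure Ω) {f : Ω → ℝ≥0∞}
    (hf : Measurable f) : expect ρ f = ∫⁻ ω, f ω ∂ρ :=
  le_antisymm (iInf_le_of_le f (iInf_le_of_le hf (iInf_le_of_le le_rfl le_rfl)))
    (le_iInf fun _ => le_iInf fun _ => le_iInf fun hg => lintegral_mono hg)

/-- The expected max-sliced error `𝔼 MSΔ(P_n, P)` of the empirical law of the sample `X`. -/
def expectedError (Δ : ProbabilityMeasure ℝ → ProbabilityMeasure ℝ → ℝ≥0∞) {d n : ℕ} [NeZero n]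
    {Ω : Type*} [MeasurableSpace Ω] (ρ : Measure Ω) (X : Fin n → Ω → EuclideanSpace ℝ (Fin d))
    (P : ProbabilityMeasure (EuclideanSpace ℝ (Fin d))) : ℝ≥0∞ :=
  expect ρ fun ω => maxSliced Δ (empirical fun i => X i ω) P

/-- The `p`-Wasserstein distance on `ℝ`, as an infimum over couplings. -/
def wasserstein (p : ℝ) (μ ν : ProbabilityMeasure ℝ) : ℝ≥0∞ :=
  (⨅ (π : Measure (ℝ × ℝ)) (_ : π.map Prod.fst = μ) (_ : π.map Prod.snd = ν),
    ∫⁻ z, edist z.1 z.2 ^ p ∂π) ^ (1 / p)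

/-- The Cramér distance `‖F_μ - F_ν‖_{L²(ℝ)}`. -/
def cramer (μ ν : ProbabilityMeasure ℝ) : ℝ≥0∞ :=
  (∫⁻ t : ℝ, ENNReal.ofReal (|cdf (μ : Measure ℝ) t - cdf (ν : Measure ℝ) t| ^ 2)) ^ (1 / 2 : ℝ)

end

end MaxSlicing

namespace MaxSlicing

/-! The distribution function of `project θ μ` at `t` is the `μ`-mass of the half-space with normal
`θ` and offset `t`. Hence `‖F - G‖_∞`, uniformly over all directions, is controlled by the uniform
deviation of the empirical law over half-spaces, and CDF dominance transfers this control to the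
max-sliced divergence.

Half-spaces have VC dimension at most `d + 1` by Radon's theorem (`card_le_of_shatters_halfspace`),
so by Sauer–Shelah they cut at most `(2n + 1) ^ (d + 1)` subsets out of `2n` points. A ghost sample,
symmetrization by swaps and Massart's lemma (`massart`) bound the expected uniform deviation by a
multiple of `√((d + 1) log (n + 1) / n)` (`lintegral_uniformDeviation_le`); Jensen's inequality
handles the power `α ≤ 1`. A dense sequence of half-spaces suffices, so the majorant is measurable
and bounds the outer expectation.

The concrete divergences are instances: the quantile coupling gives `W_p ≤ D ‖F - G‖_∞ ^ (1 / p)`,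
and the Cramér distance is at most `√D ‖F - G‖_∞` because `F - G` vanishes off an interval of length
at most `D`. -/

/-- The partial sums of a row of Pascal's triangle grow polynomially. -/
theorem sum_choose_le_pow (N m : ℕ) : ∑ k ∈ Finset.Iic m, N.choose k ≤ (N + 1) ^ m := by
  rw [add_pow, show Finset.Iic m = Finset.range (m + 1) by ext; simp]
  refine Finset.sum_le_sum fun k hk => ?_
  have hk' : k ≤ m := Nat.lt_succ_iff.1 (Finset.mem_range.1 hk)
  calc N.choose k ≤ N ^ k := Nat.choose_le_pow N k
    _ ≤ N ^ k * 1 ^ (m - k) * m.choose k := by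
      simpa using Nat.le_mul_of_pos_right _ (Nat.choose_pos hk')

/-! ### VC dimension of half-spaces -/

section Halfspaces

variable {E : Type*} [NormedAddCommGroup E] [InnerProductSpace ℝ E]

/-- The closed half-space `{x | ⟪q.1, x⟫ ≤ q.2}`. -/
def halfspace (q : E × ℝ) : Set E := {x | inner ℝ q.1 x ≤ q.2}

theorem measurableSet_halfspace [MeasurableSpace E] [OpensMeasurableSpace E]
    (q : E × ℝ) : MeasurableSet (halfspace q) :=
  (isClosed_le (by fun_prop) continuous_const).measurableSet

theorem convex_halfspace (q : E × ℝ) : Convex ℝ (halfspace q) :=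
  convex_halfSpace_le (innerₗ E q.1).isLinear q.2

theorem convex_compl_halfspace (q : E × ℝ) : Convex ℝ (halfspace q)ᶜ := by
  have h : (halfspace q)ᶜ = {x | q.2 < innerₗ E q.1 x} := by ext; simp [halfspace]
  rw [h]
  exact convex_halfSpace_gt (innerₗ E q.1).isLinear q.2

open scoped Classical in
/-- Half-spaces cannot shatter more than `dim E + 1` points. -/
theorem card_le_of_shatters_halfspace [FiniteDimensional ℝ E] {ι : Type*} [Fintype ι] (w : ι → E)
    {𝒜 : Finset (Finset ι)}
    (h𝒜 : ∀ u ∈ 𝒜, ∃ q : E × ℝ, ∀ i, i ∈ u ↔ w i ∈ halfspace q)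
    {s : Finset ι} (hs : 𝒜.Shatters s) : s.card ≤ Module.finrank ℝ E + 1 := by
  by_contra! hcard
  have hdep : ¬ AffineIndependent ℝ (fun i : s => w i) := by
    intro h
    have := h.card_le_finrank_succ
    simp only [Fintype.card_coe] at this
    have h2 := Submodule.finrank_le (vectorSpan ℝ (Set.range fun i : s => w i))
    omega
  obtain ⟨I, p, hp, hp'⟩ := Convex.radon_partition hdep
  -- Shattering yields a half-space that separates the two Radon parts. It and its complement are
  -- convex, so the two hulls would be disjoint.
  obtain ⟨u, hu, hsu⟩ := hs (t := s.filter fun i => ∃ h : i ∈ s, (⟨i, h⟩ : s) ∈ I)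
    (Finset.filter_subset _ _)
  obtain ⟨q, hq⟩ := h𝒜 u hu
  have key : ∀ i : s, w i ∈ halfspace q ↔ i ∈ I := by
    intro i
    rw [← hq]
    have := Finset.ext_iff.1 hsu i
    simpa using this
  have h1 : convexHull ℝ ((fun i : s => w i) '' I) ⊆ halfspace q :=
    convexHull_min (by rintro _ ⟨i, hi, rfl⟩; exact (key i).2 hi) (convex_halfspace q)
  have h2 : convexHull ℝ ((fun i : s => w i) '' Iᶜ) ⊆ (halfspace q)ᶜ :=
    convexHull_min (by rintro _ ⟨i, hi, rfl⟩; exact fun h => hi ((key i).1 h))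
      (convex_compl_halfspace q)
  exact h2 hp' (h1 hp)

open scoped Classical in
/-- Half-spaces cut out at most `(N + 1) ^ (dim E + 1)` subsets of `N` points. -/
theorem card_halfspace_traces_le [FiniteDimensional ℝ E] {ι : Type*} [Fintype ι] (w : ι → E)
    (𝒜 : Finset (Finset ι))
    (h𝒜 : ∀ u ∈ 𝒜, ∃ q : E × ℝ, ∀ i, i ∈ u ↔ w i ∈ halfspace q) :
    𝒜.card ≤ (Fintype.card ι + 1) ^ (Module.finrank ℝ E + 1) := by
  have hdim : 𝒜.vcDim ≤ Module.finrank ℝ E + 1 :=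
    Finset.sup_le fun s hs => card_le_of_shatters_halfspace w h𝒜 (Finset.mem_shatterer.1 hs)
  calc 𝒜.card ≤ 𝒜.shatterer.card := Finset.card_le_card_shatterer 𝒜
    _ ≤ ∑ k ∈ Finset.Iic 𝒜.vcDim, (Fintype.card ι).choose k :=
      Finset.card_shatterer_le_sum_vcDim
    _ ≤ (Fintype.card ι + 1) ^ 𝒜.vcDim := sum_choose_le_pow _ _
    _ ≤ _ := Nat.pow_le_pow_right (Nat.succ_pos _) hdim

end Halfspaces

/-! ### Rademacher sums over a finite class -/

section Massart

/-- The sign `±1` encoded by a Boolean. -/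
def boolSign (b : Bool) : ℝ := if b then 1 else -1

theorem sum_exp_signs {n : ℕ} (v : Fin n → ℝ) :
    ∑ σ : Fin n → Bool, Real.exp (∑ i, boolSign (σ i) * v i) = 2 ^ n * ∏ i, Real.cosh (v i) := by
  have h : ∀ i, ∑ b : Bool, Real.exp (boolSign b * v i) = 2 * Real.cosh (v i) := by
    intro i
    simp [boolSign, Real.cosh_eq]
    ring
  calc ∑ σ : Fin n → Bool, Real.exp (∑ i, boolSign (σ i) * v i)
      = ∑ σ : Fin n → Bool, ∏ i, Real.exp (boolSign (σ i) * v i) := by simp [Real.exp_sum]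
    _ = ∏ i, ∑ b : Bool, Real.exp (boolSign b * v i) := by
      rw [Finset.prod_univ_sum, Fintype.piFinset_univ]
    _ = 2 ^ n * ∏ i, Real.cosh (v i) := by
      simp only [h, Finset.prod_mul_distrib]; simp

/-- Signs are sub-Gaussian: `cosh t ≤ exp (t ^ 2 / 2)` in each factor. -/
theorem sum_exp_signs_le {n : ℕ} {v : Fin n → ℝ} (hv : ∀ i, |v i| ≤ 1) (c : ℝ) :
    ∑ σ : Fin n → Bool, Real.exp (c * ∑ i, boolSign (σ i) * v i)
      ≤ 2 ^ n * Real.exp (n * c ^ 2 / 2) := by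
  have h := sum_exp_signs fun i => c * v i
  simp only [Finset.mul_sum, mul_left_comm c]
  rw [h]
  gcongr
  calc ∏ i, Real.cosh (c * v i) ≤ ∏ _i : Fin n, Real.exp (c ^ 2 / 2) := by
        refine Finset.prod_le_prod (fun i _ => (Real.cosh_pos _).le) fun i _ => ?_
        refine (Real.cosh_le_exp_half_sq _).trans ?_
        rw [Real.exp_le_exp, mul_pow]
        have : v i ^ 2 ≤ 1 := (sq_le_one_iff_abs_le_one _).2 (hv i)
        nlinarith [sq_nonneg c]
    _ = Real.exp (n * c ^ 2 / 2) := by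
        rw [Finset.prod_const, ← Real.exp_nat_mul]; simp; ring

/-- **Massart's finite class lemma** for the supremum of the absolute values of finitely many
Rademacher sums. -/
theorem massart {n : ℕ} (hn : 0 < n) (V : Finset (Fin n → ℝ)) (hV : ∀ v ∈ V, ∀ i, |v i| ≤ 1)
    {N : ℕ} (hN : 1 ≤ N) (hcard : V.card ≤ N)
    (M : (Fin n → Bool) → ℝ) (hM : ∀ σ, ∃ v ∈ V, M σ = |∑ i, boolSign (σ i) * v i|) :
    (∑ σ, M σ) / 2 ^ n ≤ √(2 * n * Real.log (2 * N)) := by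
  set l := Real.log (2 * N) with hl
  have hN' : (1 : ℝ) ≤ N := by exact_mod_cast hN
  have hlpos : 0 < l := Real.log_pos (by linarith)
  have hn' : (0 : ℝ) < n := by exact_mod_cast hn
  -- This `c` minimizes `l / c + n * c / 2`; it makes `n * c ^ 2 / 2 = l`. The factor 2 in `l = log
  -- (2 * N)` pays for the absolute value, since `v` and `-v` both enter.
  set c := √(2 * l / n) with hc
  have hcpos : 0 < c := Real.sqrt_pos.2 (by positivity)
  have hcsq : c ^ 2 = 2 * l / n := Real.sq_sqrt (by positivity)
  -- the exponential moment
  have hexp : ∑ σ, Real.exp (c * M σ) ≤ 2 ^ n * (2 * N * Real.exp (n * c ^ 2 / 2)) := by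
    calc ∑ σ, Real.exp (c * M σ)
        ≤ ∑ σ : Fin n → Bool, ∑ v ∈ V, (Real.exp (c * ∑ i, boolSign (σ i) * v i) +
            Real.exp (-c * ∑ i, boolSign (σ i) * v i)) := by
          refine Finset.sum_le_sum fun σ _ => ?_
          obtain ⟨v, hv, h⟩ := hM σ
          refine le_trans ?_ (Finset.single_le_sum (f := fun v : Fin n → ℝ =>
            Real.exp (c * ∑ i, boolSign (σ i) * v i) +
            Real.exp (-c * ∑ i, boolSign (σ i) * v i))
            (fun _ _ => add_nonneg (Real.exp_pos _).le (Real.exp_pos _).le) hv)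
          rw [h]
          have h1 := Real.exp_pos (c * ∑ i, boolSign (σ i) * v i)
          have h2 := Real.exp_pos (-c * ∑ i, boolSign (σ i) * v i)
          rcases abs_choice (∑ i, boolSign (σ i) * v i) with h | h <;> rw [h]
          · linarith
          · rw [mul_neg, ← neg_mul]; linarith
      _ = ∑ v ∈ V, (∑ σ : Fin n → Bool, Real.exp (c * ∑ i, boolSign (σ i) * v i) +
            ∑ σ : Fin n → Bool, Real.exp (-c * ∑ i, boolSign (σ i) * v i)) := by
          rw [Finset.sum_comm]; simp only [Finset.sum_add_distrib]
      _ ≤ ∑ v ∈ V, (2 ^ n * Real.exp (n * c ^ 2 / 2) + 2 ^ n * Real.exp (n * c ^ 2 / 2)) := by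
          refine Finset.sum_le_sum fun v hv => add_le_add (sum_exp_signs_le (hV v hv) c) ?_
          simpa using sum_exp_signs_le (hV v hv) (-c)
      _ = V.card * (2 ^ n * Real.exp (n * c ^ 2 / 2) + 2 ^ n * Real.exp (n * c ^ 2 / 2)) := by
          rw [Finset.sum_const, nsmul_eq_mul]
      _ ≤ N * (2 ^ n * Real.exp (n * c ^ 2 / 2) + 2 ^ n * Real.exp (n * c ^ 2 / 2)) := by
          gcongr
      _ = _ := by ring
  have hK : 2 * N * Real.exp (n * c ^ 2 / 2) = Real.exp (2 * l) := by
    have h1 : (2 * N : ℝ) = Real.exp l := (Real.exp_log (by positivity)).symm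
    rw [h1, ← Real.exp_add, hcsq]
    congr 1
    field_simp
    ring
  rw [hK] at hexp
  -- the tangent line of the exponential at `2 * l`
  have htan : ∀ σ, Real.exp (2 * l) * (c * M σ - 2 * l + 1) ≤ Real.exp (c * M σ) := by
    intro σ
    have := Real.add_one_le_exp (c * M σ - 2 * l)
    calc Real.exp (2 * l) * (c * M σ - 2 * l + 1)
        ≤ Real.exp (2 * l) * Real.exp (c * M σ - 2 * l) := by gcongr
      _ = Real.exp (c * M σ) := by rw [← Real.exp_add]; congr 1; ring
  have hsum : Real.exp (2 * l) * (c * ∑ σ, M σ + 2 ^ n * (1 - 2 * l))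
      ≤ Real.exp (2 * l) * 2 ^ n := by
    calc _ = ∑ σ, Real.exp (2 * l) * (c * M σ - 2 * l + 1) := by
          rw [← Finset.mul_sum, Finset.sum_add_distrib, Finset.sum_sub_distrib, ← Finset.mul_sum]
          simp
          ring
      _ ≤ ∑ σ, Real.exp (c * M σ) := Finset.sum_le_sum fun σ _ => htan σ
      _ ≤ _ := by rw [mul_comm]; exact hexp
  have hfin := le_of_mul_le_mul_left hsum (Real.exp_pos _)
  have hpow : (0 : ℝ) < 2 ^ n := by positivity
  rw [div_le_iff₀ hpow]
  have hval : √(2 * n * l) * c = 2 * l := by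
    rw [hc, ← Real.sqrt_mul (by positivity), show 2 * n * l * (2 * l / n) = (2 * l) ^ 2 by
      field_simp, Real.sqrt_sq (by positivity)]
  refine le_of_mul_le_mul_left ?_ hcpos
  calc c * ∑ σ, M σ ≤ 2 ^ n * (2 * l) := by linarith
    _ = c * (√(2 * n * l) * 2 ^ n) := by rw [← hval]; ring

end Massart

/-! ### Symmetrization with a ghost sample -/

section Symmetrization

variable {E : Type*} {n : ℕ}

/-- The difference vector `i ↦ 1_A(x i) - 1_A(y i)` of a sequence of pairs `z i = (x i, y i)`. -/
noncomputable def pairDiff (A : Set E) (z : Fin n → E × E) (i : Fin n) : ℝ :=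
  A.indicator (fun _ => (1 : ℝ)) (z i).1 - A.indicator (fun _ => (1 : ℝ)) (z i).2

theorem abs_pairDiff_le (A : Set E) (z : Fin n → E × E) (i : Fin n) : |pairDiff A z i| ≤ 1 := by
  unfold pairDiff Set.indicator
  split_ifs <;> simp

variable [MeasurableSpace E]

/-- The centred count `∑ i, (1_A(x i) - P A)`. -/
noncomputable def deviation (P : Measure E) (A : Set E) (x : Fin n → E) : ℝ :=
  ∑ i, (A.indicator (fun _ => (1 : ℝ)) (x i) - P.real A)

theorem measurable_deviation (P : Measure E) {A : Set E} (hA : MeasurableSet A) :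
    Measurable (deviation P A : (Fin n → E) → ℝ) := by
  have := (measurable_const : Measurable fun _ : E => (1 : ℝ)).indicator hA
  unfold deviation
  fun_prop

theorem measurable_pairDiff {A : Set E} (hA : MeasurableSet A) (i : Fin n) :
    Measurable fun z : Fin n → E × E => pairDiff A z i := by
  have := (measurable_const : Measurable fun _ : E => (1 : ℝ)).indicator hA
  unfold pairDiff
  fun_prop

/-- Introducing an independent copy of the sample. -/
theorem enorm_deviation_le (P : Measure E) [IsProbabilityMeasure P] {A : Set E}
    (hA : MeasurableSet A) (x : Fin n → E) :
    ‖deviation P A x‖ₑ ≤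
      ∫⁻ y, ‖∑ i, pairDiff A (fun i => (x i, y i)) i‖ₑ ∂Measure.pi fun _ : Fin n => P := by
  have hint : Integrable (A.indicator fun _ => (1 : ℝ)) P :=
    (integrable_const 1).indicator hA
  have hint' : ∀ i : Fin n, Integrable (fun y : Fin n → E => A.indicator (fun _ => (1 : ℝ)) (y i))
      (Measure.pi fun _ : Fin n => P) := fun i =>
    (measurePreserving_eval (fun _ : Fin n => P) i).integrable_comp_of_integrable hint
  -- The mean of `1_A (y i)` is `P A`, so integrating out the ghost sample restores the centring.
  have h : deviation P A x =
      ∫ y, ∑ i, pairDiff A (fun i => (x i, y i)) i ∂Measure.pi fun _ : Fin n => P := by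
    rw [integral_finsetSum]
    · refine Finset.sum_congr rfl fun i _ => ?_
      simp only [pairDiff]
      rw [integral_sub (integrable_const _) (hint' i),
        integral_comp_eval (μ := fun _ : Fin n => P) hint.aestronglyMeasurable,
        integral_indicator hA]
      simp
    · intro i _
      exact (integrable_const (A.indicator (fun _ => (1 : ℝ)) (x i))).sub (hint' i)
  rw [h]
  exact enorm_integral_le_lintegral_enorm _

/-- A supremum of integrals over the ghost sample is at most the integral of the supremum. Two
samples are regrouped as one sample of pairs, on which swaps act coordinatewise. -/
theorem lintegral_iSup_deviation_le_pairs {κ : Type*} [Finite κ] (P : Measure E)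
    [IsProbabilityMeasure P] {A : κ → Set E} (hA : ∀ k, MeasurableSet (A k)) :
    ∫⁻ x, ⨆ k, ‖deviation P (A k) x‖ₑ ∂(Measure.pi fun _ : Fin n => P) ≤
      ∫⁻ z, ⨆ k, ‖∑ i, pairDiff (A k) z i‖ₑ ∂(Measure.pi fun _ : Fin n => P.prod P) := by
  have hmeas : Measurable fun z : Fin n → E × E => ⨆ k, ‖∑ i, pairDiff (A k) z i‖ₑ :=
    Measurable.iSup fun k =>
      (Finset.measurable_sum _ fun i _ => measurable_pairDiff (hA k) i).enorm
  have hpres := (measurePreserving_arrowProdEquivProdArrow E E (Fin n)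
    (fun _ => P) (fun _ => P)).symm
  rw [← hpres.lintegral_comp hmeas]
  refine le_of_le_of_eq ?_ (lintegral_prod _ (hmeas.comp hpres.measurable).aemeasurable).symm
  refine lintegral_mono fun x => iSup_le fun k => (enorm_deviation_le P (hA k) x).trans ?_
  exact lintegral_mono fun y => le_iSup
    (fun k => ‖∑ i, pairDiff (A k) (fun i => (x i, y i)) i‖ₑ) k

/-- Swapping the entries of the pairs selected by `σ` does not change their joint law. -/
theorem lintegral_pairs_eq_signs {κ : Type*} [Finite κ] (P : Measure E)
    [IsProbabilityMeasure P] {A : κ → Set E} (hA : ∀ k, MeasurableSet (A k))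
    (σ : Fin n → Bool) :
    ∫⁻ z, ⨆ k, ‖∑ i, pairDiff (A k) z i‖ₑ ∂(Measure.pi fun _ : Fin n => P.prod P) =
      ∫⁻ z, ⨆ k, ‖∑ i, boolSign (σ i) * pairDiff (A k) z i‖ₑ
        ∂(Measure.pi fun _ : Fin n => P.prod P) := by
  have hmeas : Measurable fun z : Fin n → E × E => ⨆ k, ‖∑ i, pairDiff (A k) z i‖ₑ :=
    Measurable.iSup fun k =>
      (Finset.measurable_sum _ fun i _ => measurable_pairDiff (hA k) i).enorm
  have hpres : MeasurePreserving
      (fun (z : Fin n → E × E) i => (if σ i then id else Prod.swap) (z i))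
      (Measure.pi fun _ : Fin n => P.prod P) (Measure.pi fun _ : Fin n => P.prod P) := by
    refine measurePreserving_pi _ _ fun i => ?_
    split_ifs
    · exact MeasurePreserving.id _
    · exact Measure.measurePreserving_swap
  rw [← hpres.lintegral_comp hmeas]
  refine lintegral_congr fun z => iSup_congr fun k => ?_
  congr 1
  refine Finset.sum_congr rfl fun i _ => ?_
  cases h : σ i <;> simp [pairDiff, boolSign, h]

/-- The expected maximal deviation of finitely many sets that have at most `N` distinct difference
vectors on any sequence of pairs. -/
theorem lintegral_iSup_deviation_le_of_finite {κ : Type*} [Finite κ] [Nonempty κ] (hn : 0 < n)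
    (P : Measure E) [IsProbabilityMeasure P] {A : κ → Set E} (hA : ∀ k, MeasurableSet (A k))
    {N : ℕ} (hN : 1 ≤ N)
    (hV : ∀ z : Fin n → E × E, ∃ V : Finset (Fin n → ℝ), V.card ≤ N ∧ ∀ k, pairDiff (A k) z ∈ V) :
    ∫⁻ x, ⨆ k, ‖deviation P (A k) x‖ₑ ∂(Measure.pi fun _ : Fin n => P) ≤
      ENNReal.ofReal √(2 * n * Real.log (2 * N)) := by
  classical
  refine (lintegral_iSup_deviation_le_pairs P hA).trans ?_
  set I := ∫⁻ z, ⨆ k, ‖∑ i, pairDiff (A k) z i‖ₑ ∂(Measure.pi fun _ : Fin n => P.prod P) with hI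
  set B := √(2 * n * Real.log (2 * N)) with hB
  have hpt : ∀ z : Fin n → E × E, ∑ σ : Fin n → Bool,
      ⨆ k, ‖∑ i, boolSign (σ i) * pairDiff (A k) z i‖ₑ ≤ 2 ^ n * ENNReal.ofReal B := by
    intro z
    obtain ⟨V, hVN, hVmem⟩ := hV z
    have hmax : ∀ σ : Fin n → Bool, ∃ k,
        ‖∑ i, boolSign (σ i) * pairDiff (A k) z i‖ₑ =
          ⨆ k, ‖∑ i, boolSign (σ i) * pairDiff (A k) z i‖ₑ := fun σ =>
      exists_eq_ciSup_of_finite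
    choose k hk using hmax
    -- `V` may contain vectors with large entries, so only actual difference vectors are kept.
    have hm := massart hn (V.filter fun v => ∃ k, v = pairDiff (A k) z)
      (by
        intro v hv i
        obtain ⟨k, rfl⟩ := (Finset.mem_filter.1 hv).2
        exact abs_pairDiff_le _ _ _) hN ((Finset.card_filter_le _ _).trans hVN)
      (fun σ => |∑ i, boolSign (σ i) * pairDiff (A (k σ)) z i|)
      (fun σ => ⟨pairDiff (A (k σ)) z, Finset.mem_filter.2 ⟨hVmem _, _, rfl⟩, rfl⟩)
    rw [div_le_iff₀ (by positivity)] at hm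
    calc ∑ σ : Fin n → Bool, ⨆ k, ‖∑ i, boolSign (σ i) * pairDiff (A k) z i‖ₑ
        = ∑ σ : Fin n → Bool, ENNReal.ofReal |∑ i, boolSign (σ i) * pairDiff (A (k σ)) z i| := by
          refine Finset.sum_congr rfl fun σ _ => ?_
          rw [← hk σ, Real.enorm_eq_ofReal_abs]
      _ = ENNReal.ofReal (∑ σ : Fin n → Bool,
            |∑ i, boolSign (σ i) * pairDiff (A (k σ)) z i|) :=
          (ENNReal.ofReal_sum_of_nonneg fun _ _ => abs_nonneg _).symm
      _ ≤ ENNReal.ofReal (B * 2 ^ n) := ENNReal.ofReal_le_ofReal hm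
      _ = 2 ^ n * ENNReal.ofReal B := by
          rw [mul_comm, ENNReal.ofReal_mul (by positivity), ENNReal.ofReal_pow (by norm_num)]
          simp
  -- Summing over all `2 ^ n` sign patterns replaces random signs: each pattern gives the same
  -- integral, and `hpt` bounds the sum for fixed pairs.
  have hmul : 2 ^ n * I ≤ 2 ^ n * ENNReal.ofReal B := by
    calc 2 ^ n * I = ∑ σ : Fin n → Bool, I := by simp
      _ = ∑ σ : Fin n → Bool, ∫⁻ z, ⨆ k, ‖∑ i, boolSign (σ i) * pairDiff (A k) z i‖ₑ
            ∂(Measure.pi fun _ : Fin n => P.prod P) :=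
          Finset.sum_congr rfl fun σ _ => lintegral_pairs_eq_signs P hA σ
      _ = ∫⁻ z, ∑ σ : Fin n → Bool, ⨆ k, ‖∑ i, boolSign (σ i) * pairDiff (A k) z i‖ₑ
            ∂(Measure.pi fun _ : Fin n => P.prod P) := by
          refine (lintegral_finsetSum _ fun σ _ => Measurable.iSup fun k => ?_).symm
          exact (Finset.measurable_sum _ fun i _ =>
            (measurable_pairDiff (hA k) i).const_mul _).enorm
      _ ≤ ∫⁻ _z, 2 ^ n * ENNReal.ofReal B ∂(Measure.pi fun _ : Fin n => P.prod P) :=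
          lintegral_mono hpt
      _ = 2 ^ n * ENNReal.ofReal B := by simp
  exact (ENNReal.mul_le_mul_iff_right (by simp) (by simp)).1 hmul

/-- The expected maximal deviation of a sequence of sets that have at most `N` distinct difference
vectors on any sequence of pairs. -/
theorem lintegral_iSup_deviation_le (hn : 0 < n)
    (P : Measure E) [IsProbabilityMeasure P] {A : ℕ → Set E} (hA : ∀ k, MeasurableSet (A k))
    {N : ℕ} (hN : 1 ≤ N)
    (hV : ∀ z : Fin n → E × E, ∃ V : Finset (Fin n → ℝ), V.card ≤ N ∧ ∀ k, pairDiff (A k) z ∈ V) :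
    ∫⁻ x, ⨆ k, ‖deviation P (A k) x‖ₑ ∂(Measure.pi fun _ : Fin n => P) ≤
      ENNReal.ofReal √(2 * n * Real.log (2 * N)) := by
  -- Exhaustion by initial segments, nonempty because of the `m + 1`, prepares monotone convergence.
  have h : ∀ x : Fin n → E, ⨆ k, ‖deviation P (A k) x‖ₑ =
      ⨆ m : ℕ, ⨆ k : Fin (m + 1), ‖deviation P (A k) x‖ₑ := fun x => le_antisymm
    (iSup_le fun k => le_iSup_of_le k
      (le_iSup (fun j : Fin (k + 1) => ‖deviation P (A j) x‖ₑ) (Fin.last k)))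
    (iSup_le fun m => iSup_le fun k => le_iSup (fun k => ‖deviation P (A k) x‖ₑ) (k : ℕ))
  simp only [h]
  rw [lintegral_iSup]
  · refine iSup_le fun m => lintegral_iSup_deviation_le_of_finite
      (A := fun k : Fin (m + 1) => A k) hn P (fun k => hA k) hN fun z => ?_
    obtain ⟨V, h1, h2⟩ := hV z
    exact ⟨V, h1, fun k => h2 k⟩
  · exact fun m => Measurable.iSup fun k => (measurable_deviation P (hA k)).enorm
  · intro m m' hm x
    exact iSup_le fun k => le_iSup (fun j : Fin (m' + 1) => ‖deviation P (A j) x‖ₑ)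
      (Fin.castLE (by omega) k)

end Symmetrization

/-! ### Counting difference vectors of half-spaces -/

section Halfspaces

variable {E : Type*} [NormedAddCommGroup E] [InnerProductSpace ℝ E]

/-- A difference vector depends only on which of the `2n` points of the pairs lie in the half-space.
-/
theorem exists_finset_pairDiff_halfspace [FiniteDimensional ℝ E] {n : ℕ} (z : Fin n → E × E) :
    ∃ V : Finset (Fin n → ℝ), V.card ≤ (2 * n + 1) ^ (Module.finrank ℝ E + 1) ∧
      ∀ q : E × ℝ, pairDiff (halfspace q) z ∈ V := by
  classical
  let w : Fin n ⊕ Fin n → E := Sum.elim (fun i => (z i).1) (fun i => (z i).2)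
  let 𝒜 : Finset (Finset (Fin n ⊕ Fin n)) :=
    Finset.univ.filter fun u => ∃ q : E × ℝ, ∀ i, i ∈ u ↔ w i ∈ halfspace q
  refine ⟨𝒜.image fun u i => (if Sum.inl i ∈ u then 1 else 0) - (if Sum.inr i ∈ u then 1 else 0),
    Finset.card_image_le.trans ?_, fun q => Finset.mem_image.2
      ⟨Finset.univ.filter fun i => w i ∈ halfspace q, by simpa [𝒜] using ⟨q.1, q.2, by simp⟩, ?_⟩⟩
  · have h := card_halfspace_traces_le w 𝒜 fun u hu => (Finset.mem_filter.1 hu).2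
    simpa [two_mul] using h
  · ext i
    simp [w, pairDiff, Set.indicator]

end Halfspaces

open Filter Topology

/-! ### Reduction to countably many half-spaces -/

section Approximation

variable {E : Type*} [NormedAddCommGroup E] [InnerProductSpace ℝ E]

/-- Every closed half-space is a pointwise limit of half-spaces from a dense sequence: perturb the
normal vector much less than the offset, and the offset upwards. -/
theorem exists_halfspace_approx {qs : ℕ → E × ℝ} (hqs : DenseRange qs) (q : E × ℝ) :
    ∃ φ : ℕ → ℕ, ∀ x, ∀ᶠ k in atTop, x ∈ halfspace (qs (φ k)) ↔ x ∈ halfspace q := by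
  let ε : ℕ → ℝ := fun k => 1 / ((k : ℝ) + 1)
  have hε : ∀ k, 0 < ε k := fun k => Nat.one_div_pos_of_nat
  have hεlim : Tendsto ε atTop (𝓝 0) := tendsto_one_div_add_atTop_nhds_zero_nat
  -- Moving the normal by `ε ^ 2` changes the inner product with a fixed `x` by at most `ε`
  -- eventually. Raising the offset by more than `ε` keeps the points of the closed half-space, and
  -- by less than `2 ε` excludes `x` outside once `3 ε` is below its gap.
  have hex : ∀ k, ∃ m, qs m ∈ Metric.ball q.1 (ε k ^ 2) ×ˢ Set.Ioo (q.2 + ε k) (q.2 + 2 * ε k) := by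
    intro k
    refine hqs.exists_mem_open (Metric.isOpen_ball.prod isOpen_Ioo) ?_
    have := hε k
    exact ⟨(q.1, q.2 + 3 / 2 * ε k), Metric.mem_ball_self (by positivity), by
      constructor <;> simp only <;> linarith⟩
  choose φ hφ using hex
  refine ⟨φ, fun x => ?_⟩
  have hclose : ∀ᶠ k in atTop, |inner ℝ (qs (φ k)).1 x - inner ℝ q.1 x| ≤ ε k := by
    have hlim : Tendsto (fun k => ε k * ‖x‖) atTop (𝓝 0) := by simpa using hεlim.mul_const ‖x‖
    filter_upwards [hlim.eventually_lt_const one_pos] with k hk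
    have hk1 : ‖(qs (φ k)).1 - q.1‖ < ε k ^ 2 := by simpa [dist_eq_norm] using (hφ k).1
    rw [← inner_sub_left]
    calc |inner ℝ ((qs (φ k)).1 - q.1) x| ≤ ‖(qs (φ k)).1 - q.1‖ * ‖x‖ :=
          abs_real_inner_le_norm _ _
      _ ≤ ε k ^ 2 * ‖x‖ := by gcongr
      _ = ε k * (ε k * ‖x‖) := by ring
      _ ≤ ε k * 1 := by gcongr
      _ = ε k := mul_one _
  by_cases hx : x ∈ halfspace q
  · filter_upwards [hclose] with k hk
    refine iff_of_true ?_ hx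
    have hx' : inner ℝ q.1 x ≤ q.2 := hx
    have := (hφ k).2.1
    have := (abs_le.1 hk).2
    change inner ℝ (qs (φ k)).1 x ≤ (qs (φ k)).2
    linarith
  · have hx' : q.2 < inner ℝ q.1 x := not_le.1 hx
    have hlim : Tendsto (fun k => 3 * ε k) atTop (𝓝 0) := by simpa using hεlim.const_mul 3
    filter_upwards [hclose, hlim.eventually_lt_const (sub_pos.2 hx')] with k hk hk'
    refine iff_of_false ?_ hx
    have := (hφ k).2.2
    have := (abs_le.1 hk).1
    change ¬ inner ℝ (qs (φ k)).1 x ≤ (qs (φ k)).2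
    linarith

/-- Pointwise convergence of indicators gives convergence of masses under a finite measure. -/
theorem enorm_halfspace_sub_le [MeasurableSpace E] [OpensMeasurableSpace E]
    {qs : ℕ → E × ℝ} (hqs : DenseRange qs) (μ ν : Measure E) [IsFiniteMeasure μ]
    [IsFiniteMeasure ν] (q : E × ℝ) :
    ‖μ.real (halfspace q) - ν.real (halfspace q)‖ₑ ≤
      ⨆ k, ‖μ.real (halfspace (qs k)) - ν.real (halfspace (qs k))‖ₑ := by
  obtain ⟨φ, hφ⟩ := exists_halfspace_approx hqs q
  have hlim : ∀ (κ : Measure E) [IsFiniteMeasure κ],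
      Tendsto (fun k => κ.real (halfspace (qs (φ k)))) atTop (𝓝 (κ.real (halfspace q))) := by
    intro κ _
    exact (ENNReal.tendsto_toReal (measure_ne_top κ _)).comp
      (tendsto_measure_of_tendsto_indicator_of_isFiniteMeasure atTop κ
        (fun k => measurableSet_halfspace _) hφ)
  exact le_of_tendsto ((hlim μ).sub (hlim ν)).enorm (Eventually.of_forall fun k =>
    le_iSup (fun k => ‖μ.real (halfspace (qs k)) - ν.real (halfspace (qs k))‖ₑ) (φ k))

end Approximation

/-! ### Uniform deviation of the empirical law -/

section Empirical

theorem empirical_real_sub {E : Type*} [MeasurableSpace E] {n : ℕ} [NeZero n] (x : Fin n → E)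
    (P : Measure E) {A : Set E} (hA : MeasurableSet A) :
    (empirical x : Measure E).real A - P.real A = (n : ℝ)⁻¹ * deviation P A x := by
  have hn : (n : ℝ) ≠ 0 := Nat.cast_ne_zero.2 (NeZero.ne n)
  have h : (empirical x : Measure E).real A =
      (n : ℝ)⁻¹ * ∑ i, A.indicator (fun _ => (1 : ℝ)) (x i) := by
    change (((n : ℝ≥0∞)⁻¹ • ∑ i, Measure.dirac (x i)) A).toReal = _
    rw [Measure.smul_apply, Measure.finsetSum_apply, smul_eq_mul, ENNReal.toReal_mul,
      ENNReal.toReal_sum (fun i _ => measure_ne_top _ _)]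
    simp only [ENNReal.toReal_inv, ENNReal.toReal_natCast]
    congr 1
    refine Finset.sum_congr rfl fun i _ => ?_
    rw [Measure.dirac_apply' _ hA]
    by_cases hx : x i ∈ A <;> simp [hx]
  rw [h, deviation, Finset.sum_sub_distrib, mul_sub]
  simp [hn]

/-- This is the bridge from directions and thresholds to half-spaces. -/
theorem cdf_project {d : ℕ} (θ : EuclideanSpace ℝ (Fin d))
    (μ : ProbabilityMeasure (EuclideanSpace ℝ (Fin d))) (t : ℝ) :
    cdf (project θ μ : Measure ℝ) t =
      (μ : Measure (EuclideanSpace ℝ (Fin d))).real (halfspace (θ, t)) := by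
  rw [cdf_eq_real]
  change ((μ : Measure (EuclideanSpace ℝ (Fin d))).map (fun x => inner ℝ θ x)).real _ = _
  rw [map_measureReal_apply (by fun_prop) measurableSet_Iic]
  rfl

theorem cdfDist_nonneg (μ ν : ProbabilityMeasure ℝ) : 0 ≤ cdfDist μ ν :=
  Real.iSup_nonneg fun _ => abs_nonneg _

theorem abs_cdf_sub_le_cdfDist (μ ν : ProbabilityMeasure ℝ) (t : ℝ) :
    |cdf (μ : Measure ℝ) t - cdf (ν : Measure ℝ) t| ≤ cdfDist μ ν := by
  -- The bound 1 is essential: a real supremum of an unbounded family would be 0.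
  refine le_ciSup (f := fun t => |cdf (μ : Measure ℝ) t - cdf (ν : Measure ℝ) t|) ⟨1, ?_⟩ t
  rintro _ ⟨s, rfl⟩
  have h1 := cdf_nonneg (μ : Measure ℝ) s
  have h2 := cdf_le_one (μ : Measure ℝ) s
  have h3 := cdf_nonneg (ν : Measure ℝ) s
  have h4 := cdf_le_one (ν : Measure ℝ) s
  exact abs_le.2 ⟨by linarith, by linarith⟩

/-- The uniform deviation of the empirical law from `P` over a dense sequence of half-spaces. -/
noncomputable def uniformDeviation {d n : ℕ}
    (P : ProbabilityMeasure (EuclideanSpace ℝ (Fin d)))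
    (x : Fin n → EuclideanSpace ℝ (Fin d)) : ℝ≥0∞ :=
  (n : ℝ≥0∞)⁻¹ * ⨆ k, ‖deviation (P : Measure (EuclideanSpace ℝ (Fin d)))
    (halfspace (TopologicalSpace.denseSeq (EuclideanSpace ℝ (Fin d) × ℝ) k)) x‖ₑ

theorem measurable_uniformDeviation {d n : ℕ}
    (P : ProbabilityMeasure (EuclideanSpace ℝ (Fin d))) :
    Measurable (uniformDeviation P : (Fin n → EuclideanSpace ℝ (Fin d)) → ℝ≥0∞) :=
  (Measurable.iSup fun _ =>
    (measurable_deviation _ (measurableSet_halfspace _)).enorm).const_mul _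

theorem ofReal_cdfDist_le_uniformDeviation {d n : ℕ} [NeZero n]
    (P : ProbabilityMeasure (EuclideanSpace ℝ (Fin d)))
    (x : Fin n → EuclideanSpace ℝ (Fin d)) (θ : EuclideanSpace ℝ (Fin d)) :
    ENNReal.ofReal (cdfDist (project θ (empirical x)) (project θ P)) ≤ uniformDeviation P x := by
  have hpt : ∀ t, ‖cdf (project θ (empirical x) : Measure ℝ) t -
      cdf (project θ P : Measure ℝ) t‖ₑ ≤ uniformDeviation P x := by
    intro t
    rw [cdf_project, cdf_project]
    refine (enorm_halfspace_sub_le (TopologicalSpace.denseRange_denseSeq _) _ _ _).trans_eq ?_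
    rw [uniformDeviation, ENNReal.mul_iSup]
    refine iSup_congr fun k => ?_
    rw [empirical_real_sub x _ (measurableSet_halfspace _), enorm_mul]
    congr 1
    rw [Real.enorm_eq_ofReal (by positivity), ENNReal.ofReal_inv_of_pos
      (Nat.cast_pos.2 (NeZero.pos n)), ENNReal.ofReal_natCast]
  by_cases htop : uniformDeviation P x = ∞
  · simp [htop]
  rw [ENNReal.ofReal_le_iff_le_toReal htop]
  refine ciSup_le fun t => ?_
  rw [← ENNReal.ofReal_le_iff_le_toReal htop, ← Real.enorm_eq_ofReal_abs]
  exact hpt t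

theorem lintegral_uniformDeviation_le {d n : ℕ} (hn : 0 < n)
    (P : ProbabilityMeasure (EuclideanSpace ℝ (Fin d))) :
    ∫⁻ x, uniformDeviation P x
        ∂(Measure.pi fun _ : Fin n => (P : Measure (EuclideanSpace ℝ (Fin d)))) ≤
      ENNReal.ofReal √(32 * (d + 1) * Real.log (n + 1) / n) := by
  have hn' : (0 : ℝ) < n := Nat.cast_pos.2 hn
  have h := lintegral_iSup_deviation_le hn (P : Measure (EuclideanSpace ℝ (Fin d)))
    (A := fun k => halfspace (TopologicalSpace.denseSeq (EuclideanSpace ℝ (Fin d) × ℝ) k))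
    (fun k => measurableSet_halfspace _) (N := (2 * n + 1) ^ (d + 1))
    (Nat.one_le_pow _ _ (by omega)) (fun z => by
      obtain ⟨V, hV, hV'⟩ := exists_finset_pairDiff_halfspace z
      exact ⟨V, by simpa using hV, fun k => hV' _⟩)
  unfold uniformDeviation
  rw [lintegral_const_mul _ (Measurable.iSup fun _ =>
    (measurable_deviation _ (measurableSet_halfspace _)).enorm)]
  refine (mul_le_mul_right h _).trans ?_
  rw [← ENNReal.ofReal_natCast, ← ENNReal.ofReal_inv_of_pos hn',
    ← ENNReal.ofReal_mul (by positivity)]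
  refine ENNReal.ofReal_le_ofReal (Real.le_sqrt_of_sq_le ?_)
  -- Since `2 ≤ n + 1` and `2n + 1 ≤ (n + 1) ^ 2`, the factor 3 would do; 16 is what the stated
  -- constant `32 = 2 * 16` allows.
  have hlog : Real.log (2 * ((2 * n + 1) ^ (d + 1) : ℕ)) ≤ 16 * (d + 1) * Real.log (n + 1) := by
    have h1 : (2 * ((2 * n + 1) ^ (d + 1) : ℕ) : ℝ) ≤ ((n : ℝ) + 1) ^ (3 * (d + 1)) := by
      have hn1 : (1 : ℝ) ≤ n := by exact_mod_cast hn
      push_cast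
      calc (2 : ℝ) * (2 * n + 1) ^ (d + 1) ≤ (n + 1) ^ (d + 1) * ((n + 1) ^ 2) ^ (d + 1) := by
            gcongr
            · calc (2 : ℝ) ≤ n + 1 := by linarith
                _ ≤ (n + 1) ^ (d + 1) := le_self_pow₀ (by linarith) (by omega)
            · nlinarith
        _ = _ := by rw [← mul_pow, pow_mul]; ring
    have h2 := Real.log_le_log (by positivity) h1
    rw [Real.log_pow] at h2
    refine h2.trans ?_
    have : 0 ≤ Real.log ((n : ℝ) + 1) := Real.log_nonneg (by linarith)
    push_cast
    gcongr
    norm_num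
  have hlog0 : 0 ≤ Real.log (2 * ((2 * n + 1) ^ (d + 1) : ℕ)) := by
    have : 1 ≤ (2 * n + 1) ^ (d + 1) := Nat.one_le_pow _ _ (by omega)
    have : (1 : ℝ) ≤ ((2 * n + 1) ^ (d + 1) : ℕ) := by exact_mod_cast this
    exact Real.log_nonneg (by linarith)
  rw [mul_pow, Real.sq_sqrt (by positivity), le_div_iff₀ hn']
  calc _ = 2 * Real.log (2 * ((2 * n + 1) ^ (d + 1) : ℕ)) := by field_simp
    _ ≤ _ := by linarith

end Empirical

/-! ### Outer expectation and Jensen's inequality -/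

section Expectation

/-- Almost sure majorants bound the outer expectation. -/
theorem expect_le_lintegral {Ω : Type*} [MeasurableSpace Ω] (ρ : Measure Ω) {f g : Ω → ℝ≥0∞}
    (hg : AEMeasurable g ρ) (hfg : f ≤ᵐ[ρ] g) : expect ρ f ≤ ∫⁻ ω, g ω ∂ρ := by
  classical
  obtain ⟨s, hs, hsm, hs0⟩ := exists_measurable_superset_of_null
    (show ρ {ω | f ω ≤ hg.mk g ω}ᶜ = 0 by
      have h : ∀ᵐ ω ∂ρ, f ω ≤ hg.mk g ω := by
        filter_upwards [hfg, hg.ae_eq_mk] with ω h1 h2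
        exact h2 ▸ h1
      exact h)
  -- The majorant is set to `∞` on a measurable null set containing the exceptional points, which
  -- leaves its integral unchanged.
  refine iInf_le_of_le (s.piecewise (fun _ => ∞) (hg.mk g)) (iInf_le_of_le
    (Measurable.piecewise hsm measurable_const hg.measurable_mk) (iInf_le_of_le ?_ ?_))
  · intro ω
    by_cases hω : ω ∈ s
    · simp [hω]
    · rw [Set.piecewise_eq_of_notMem _ _ _ hω]
      by_contra h
      exact hω (hs h)
  · refine (lintegral_congr_ae ?_).le
    filter_upwards [hg.ae_eq_mk, measure_eq_zero_iff_ae_notMem.1 hs0] with ω h1 h2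
    rw [Set.piecewise_eq_of_notMem _ _ _ h2, h1]

/-- Jensen's inequality for a concave power, read off from the monotonicity of `L^p` norms in the
exponent on a probability space. -/
theorem lintegral_rpow_le_rpow_lintegral {Ω : Type*} [MeasurableSpace Ω] (ρ : Measure Ω)
    [IsProbabilityMeasure ρ] {f : Ω → ℝ≥0∞} (hf : Measurable f) {α : ℝ} (hα : 0 < α)
    (hα1 : α ≤ 1) : ∫⁻ ω, f ω ^ α ∂ρ ≤ (∫⁻ ω, f ω ∂ρ) ^ α := by
  have h := eLpNorm'_le_eLpNorm'_of_exponent_le hα hα1 ρ hf.stronglyMeasurable.aestronglyMeasurable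
  simp only [eLpNorm', enorm_eq_self, ENNReal.rpow_one, div_one] at h
  rwa [one_div, ENNReal.rpow_inv_le_iff hα] at h

end Expectation

/-! ### Projected supports -/

section Support

/-- The projections of a law whose support has diameter at most `D`, and of the empirical law of
points in this support, live on a common interval of length at most `D`. -/
theorem exists_Icc_project {d n : ℕ} [NeZero n] {D : ℝ}
    {P : ProbabilityMeasure (EuclideanSpace ℝ (Fin d))} (hP : SuppDiamLE P D) (hD : 0 ≤ D)
    {x : Fin n → EuclideanSpace ℝ (Fin d)}
    (hx : ∀ i, x i ∈ (P : Measure (EuclideanSpace ℝ (Fin d))).support)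
    {θ : EuclideanSpace ℝ (Fin d)} (hθ : ‖θ‖ = 1) :
    ∃ a b : ℝ, b - a ≤ D ∧ (project θ (empirical x) : Measure ℝ) (Set.Icc a b)ᶜ = 0 ∧
      (project θ P : Measure ℝ) (Set.Icc a b)ᶜ = 0 := by
  set S := (P : Measure (EuclideanSpace ℝ (Fin d))).support with hS
  let T : Set ℝ := (fun y => inner ℝ θ y) '' S
  -- The sample point `x 0`, available as `n ≥ 1`, makes the infimum and supremum of `T` meaningful.
  have hTne : T.Nonempty := ⟨_, x 0, hx 0, rfl⟩
  have hdiff : ∀ y ∈ T, ∀ z ∈ T, y - z ≤ D := by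
    rintro _ ⟨y, hy, rfl⟩ _ ⟨z, hz, rfl⟩
    have hdist : dist y z ≤ D := by
      have := (Metric.edist_le_ediam_of_mem hy hz).trans hP
      rwa [edist_dist, ENNReal.ofReal_le_ofReal_iff hD] at this
    calc inner ℝ θ y - inner ℝ θ z = inner ℝ θ (y - z) := (inner_sub_right _ _ _).symm
      _ ≤ ‖θ‖ * ‖y - z‖ := real_inner_le_norm _ _
      _ ≤ D := by rw [hθ, one_mul, ← dist_eq_norm]; exact hdist
  have hbelow : BddBelow T :=
    ⟨inner ℝ θ (x 0) - D, fun y hy => by linarith [hdiff _ ⟨x 0, hx 0, rfl⟩ y hy]⟩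
  have habove : BddAbove T :=
    ⟨inner ℝ θ (x 0) + D, fun y hy => by linarith [hdiff y hy _ ⟨x 0, hx 0, rfl⟩]⟩
  have hmem : ∀ y ∈ S, inner ℝ θ y ∈ Set.Icc (sInf T) (sSup T) := fun y hy =>
    ⟨csInf_le hbelow ⟨y, hy, rfl⟩, le_csSup habove ⟨y, hy, rfl⟩⟩
  have hproj : ∀ μ : ProbabilityMeasure (EuclideanSpace ℝ (Fin d)),
      (μ : Measure (EuclideanSpace ℝ (Fin d))) Sᶜ = 0 →
      (project θ μ : Measure ℝ) (Set.Icc (sInf T) (sSup T))ᶜ = 0 := by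
    intro μ hμ
    change ((μ : Measure (EuclideanSpace ℝ (Fin d))).map (fun x => inner ℝ θ x)) _ = 0
    rw [Measure.map_apply (by fun_prop) measurableSet_Icc.compl]
    exact measure_mono_null (fun y hy hyS => hy (hmem y hyS)) hμ
  refine ⟨sInf T, sSup T, ?_, hproj _ ?_, hproj _ Measure.measure_compl_support⟩
  · have h1 : sSup T ≤ sInf T + D := csSup_le hTne fun y hy => by
      have : y - D ≤ sInf T := le_csInf hTne fun z hz => by linarith [hdiff y hy z hz]
      linarith
    linarith
  · change ((n : ℝ≥0∞)⁻¹ • ∑ i, Measure.dirac (x i)) Sᶜ = 0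
    rw [Measure.smul_apply, Measure.finsetSum_apply]
    have hSm : MeasurableSet Sᶜ := Measure.isClosed_support.measurableSet.compl
    simp [Measure.dirac_apply' _ hSm, hx]

end Support

/-- The expected max-sliced error of a divergence dominated by the distribution functions. -/
theorem expectedError_le {d n : ℕ} [NeZero n] {L α D β : ℝ} (hL : 0 < L) (hα : 0 < α)
    (hα1 : α ≤ 1) (hD : 0 ≤ D) {Δ : ProbabilityMeasure ℝ → ProbabilityMeasure ℝ → ℝ≥0∞}
    {P : ProbabilityMeasure (EuclideanSpace ℝ (Fin d))} {Ω : Type*} [MeasurableSpace Ω]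
    {ρ : Measure Ω} [IsProbabilityMeasure ρ] {X : Fin n → Ω → EuclideanSpace ℝ (Fin d)}
    (hP : SuppDiamLE P D) (hΔ : CDFDominated Δ D L β α) (hX : IsIIDSample X P ρ) :
    expectedError Δ ρ X P ≤
      ENNReal.ofReal (L * D ^ β * √(32 * (d + 1) * Real.log (n + 1) / n) ^ α) := by
  have hXm : AEMeasurable (fun ω i => X i ω) ρ :=
    aemeasurable_pi_lambda _ fun i => (hX.law i).aemeasurable
  have hmap : ρ.map (fun ω i => X i ω) =
      Measure.pi fun _ : Fin n => (P : Measure (EuclideanSpace ℝ (Fin d))) := by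
    rw [(iIndepFun_iff_map_fun_eq_pi_map fun i => (hX.law i).aemeasurable).1 hX.indep]
    simp only [(hX.law _).map_eq]
  have hsupp : ∀ᵐ ω ∂ρ, ∀ i, X i ω ∈ (P : Measure (EuclideanSpace ℝ (Fin d))).support := by
    refine ae_all_iff.2 fun i => ?_
    have h : ∀ᵐ y ∂(ρ.map (X i)), y ∈ (P : Measure (EuclideanSpace ℝ (Fin d))).support := by
      rw [(hX.law i).map_eq]
      exact Measure.support_mem_ae
    exact ae_of_ae_map (hX.law i).aemeasurable h
  have hc : 0 ≤ L * D ^ β := mul_nonneg hL.le (Real.rpow_nonneg hD β)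
  have hG : Measurable fun x : Fin n → EuclideanSpace ℝ (Fin d) =>
      ENNReal.ofReal (L * D ^ β) * uniformDeviation P x ^ α :=
    ((measurable_uniformDeviation P).pow_const α).const_mul _
  calc expectedError Δ ρ X P
      ≤ ∫⁻ ω, ENNReal.ofReal (L * D ^ β) * uniformDeviation P (fun i => X i ω) ^ α ∂ρ := by
        -- The majorant is measurable and free of `θ`. It holds only almost surely, since the sample
        -- must lie in the support.
        refine expect_le_lintegral ρ (hG.comp_aemeasurable hXm) ?_
        filter_upwards [hsupp] with ω hω
        refine iSup_le fun θ => ?_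
        obtain ⟨a, b, hab, h1, h2⟩ :=
          exists_Icc_project hP hD hω (θ := (θ : EuclideanSpace ℝ (Fin d))) (by simp)
        refine (hΔ _ _ a b hab h1 h2).trans ?_
        rw [ENNReal.ofReal_mul hc, ← ENNReal.ofReal_rpow_of_nonneg (cdfDist_nonneg _ _) hα.le]
        gcongr
        exact ofReal_cdfDist_le_uniformDeviation P _ _
    _ = ∫⁻ x, ENNReal.ofReal (L * D ^ β) * uniformDeviation P x ^ α
          ∂(Measure.pi fun _ : Fin n => (P : Measure (EuclideanSpace ℝ (Fin d)))) := by
        rw [← hmap, lintegral_map' hG.aemeasurable hXm]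
    _ = ENNReal.ofReal (L * D ^ β) * ∫⁻ x, uniformDeviation P x ^ α
          ∂(Measure.pi fun _ : Fin n => (P : Measure (EuclideanSpace ℝ (Fin d)))) :=
        lintegral_const_mul _ ((measurable_uniformDeviation P).pow_const α)
    _ ≤ ENNReal.ofReal (L * D ^ β) *
          ENNReal.ofReal √(32 * (d + 1) * Real.log (n + 1) / n) ^ α := by
        gcongr
        refine (lintegral_rpow_le_rpow_lintegral _ (measurable_uniformDeviation P) hα hα1).trans ?_
        gcongr
        exact lintegral_uniformDeviation_le (NeZero.pos n) P
    _ = _ := by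
        rw [ENNReal.ofReal_rpow_of_nonneg (Real.sqrt_nonneg _) hα.le, ← ENNReal.ofReal_mul hc]

/-! ### Quantile functions -/

section Quantile

/-- The quantile function of a law on `ℝ`. -/
noncomputable def quantile (μ : Measure ℝ) (u : ℝ) : ℝ := sInf {t | u ≤ cdf μ t}

/-- Right continuity of the distribution function makes the infimum attained; `0 < u < 1` makes the
set bounded below and nonempty. -/
theorem quantile_le_iff (μ : Measure ℝ) {u : ℝ} (hu : u ∈ Set.Ioo (0 : ℝ) 1) (t : ℝ) :
    quantile μ u ≤ t ↔ u ≤ cdf μ t := by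
  have hne : {t | u ≤ cdf μ t}.Nonempty :=
    ((tendsto_cdf_atTop μ).eventually_const_le hu.2).exists
  have hbdd : BddBelow {t | u ≤ cdf μ t} := by
    obtain ⟨s, hs⟩ := ((tendsto_cdf_atBot μ).eventually_lt_const hu.1).exists
    refine ⟨s, fun t ht => le_of_not_gt fun hts => ?_⟩
    exact absurd (ht.trans (monotone_cdf μ hts.le)) (not_le.2 hs)
  refine ⟨fun h => ?_, fun h => csInf_le hbdd h⟩
  refine le_trans ?_ (monotone_cdf μ h)
  have hlim : Tendsto (cdf μ) (𝓝[>] quantile μ u) (𝓝 (cdf μ (quantile μ u))) :=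
    ((cdf μ).right_continuous _).mono_left (nhdsWithin_mono _ Set.Ioi_subset_Ici_self)
  refine ge_of_tendsto hlim ?_
  filter_upwards [self_mem_nhdsWithin] with s hs
  obtain ⟨r, hr, hrs⟩ := exists_lt_of_csInf_lt hne hs
  exact hr.trans (monotone_cdf μ hrs.le)

theorem aemeasurable_quantile (μ : Measure ℝ) :
    AEMeasurable (quantile μ) (volume.restrict (Set.Ioo (0 : ℝ) 1)) := by
  refine aemeasurable_restrict_of_monotoneOn measurableSet_Ioo fun u hu v hv huv => ?_
  exact (quantile_le_iff μ hu _).2 (huv.trans ((quantile_le_iff μ hv _).1 le_rfl))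

/-- Inverse transform sampling: on `(0, 1)` the event `quantile μ u ≤ t` is `u ≤ cdf μ t`, of length
`cdf μ t`. -/
theorem map_quantile (μ : Measure ℝ) [IsProbabilityMeasure μ] :
    (volume.restrict (Set.Ioo (0 : ℝ) 1)).map (quantile μ) = μ := by
  have : IsFiniteMeasure ((volume.restrict (Set.Ioo (0 : ℝ) 1)).map (quantile μ)) :=
    inferInstance
  refine Measure.ext_of_Iic _ _ fun t => ?_
  rw [Measure.map_apply_of_aemeasurable (aemeasurable_quantile μ) measurableSet_Iic,
    Measure.restrict_apply' measurableSet_Ioo, ← ofReal_cdf]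
  have hset : quantile μ ⁻¹' Set.Iic t ∩ Set.Ioo 0 1 = Set.Iic (cdf μ t) ∩ Set.Ioo 0 1 := by
    ext u
    simp only [Set.mem_inter_iff, Set.mem_preimage, Set.mem_Iic]
    exact and_congr_left fun hu => quantile_le_iff μ hu t
  rw [hset]
  refine le_antisymm ?_ ?_
  · calc volume (Set.Iic (cdf μ t) ∩ Set.Ioo 0 1) ≤ volume (Set.Ioc 0 (cdf μ t)) :=
          measure_mono fun u hu => ⟨hu.2.1, hu.1⟩
      _ = _ := by simp
  · calc ENNReal.ofReal (cdf μ t) = volume (Set.Ioo 0 (cdf μ t)) := by simp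
      _ ≤ volume (Set.Iic (cdf μ t) ∩ Set.Ioo 0 1) :=
          measure_mono fun u hu => ⟨hu.2.le, hu.1, hu.2.trans_le (cdf_le_one μ t)⟩

variable {μ : Measure ℝ} [IsProbabilityMeasure μ] {a b : ℝ}

theorem cdf_eq_zero_of_lt (hμ : μ (Set.Icc a b)ᶜ = 0) {t : ℝ} (ht : t < a) : cdf μ t = 0 := by
  rw [cdf_eq_real, measureReal_def, measure_mono_null _ hμ, ENNReal.toReal_zero]
  exact fun s hs h => absurd (h.1.trans hs) (not_le.2 ht)

theorem cdf_eq_one_of_le (hμ : μ (Set.Icc a b)ᶜ = 0) {t : ℝ} (ht : b ≤ t) : cdf μ t = 1 := by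
  have h : μ (Set.Iic t)ᶜ = 0 := measure_mono_null
    (Set.compl_subset_compl.2 fun s hs => hs.2.trans ht) hμ
  rw [cdf_eq_real, measureReal_def, (prob_compl_eq_zero_iff measurableSet_Iic).1 h,
    ENNReal.toReal_one]

theorem quantile_mem_Icc (hμ : μ (Set.Icc a b)ᶜ = 0) {u : ℝ} (hu : u ∈ Set.Ioo (0 : ℝ) 1) :
    quantile μ u ∈ Set.Icc a b := by
  constructor
  · refine le_of_not_gt fun h => ?_
    have h1 := (quantile_le_iff μ hu _).1 le_rfl
    rw [cdf_eq_zero_of_lt hμ h] at h1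
    exact absurd hu.1 (not_lt.2 h1)
  · rw [quantile_le_iff μ hu, cdf_eq_one_of_le hμ le_rfl]
    exact hu.2.le

theorem le_of_measure_compl_Icc_eq_zero (hμ : μ (Set.Icc a b)ᶜ = 0) : a ≤ b := by
  have h := quantile_mem_Icc hμ (u := 1 / 2) (by norm_num)
  exact h.1.trans h.2

end Quantile

/-! ### CDF dominance of the Wasserstein and Cramér distances -/

section Dominated

variable {μ ν : ProbabilityMeasure ℝ} {a b : ℝ}

/-- The quantile coupling has expected distance at most `(b - a) ‖F_μ - F_ν‖_∞`. -/
theorem lintegral_edist_quantile_le (hμ : (μ : Measure ℝ) (Set.Icc a b)ᶜ = 0)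
    (hν : (ν : Measure ℝ) (Set.Icc a b)ᶜ = 0) :
    ∫⁻ u in Set.Ioo (0 : ℝ) 1, edist (quantile μ u) (quantile ν u) ≤
      ENNReal.ofReal (cdfDist μ ν) * ENNReal.ofReal (b - a) := by
  set F := cdf (μ : Measure ℝ) with hF
  set G := cdf (ν : Measure ℝ) with hG
  -- The region between the two graphs over `[a, b]`. Its slice at level `u` contains the interval
  -- between the quantiles, and its slice at `t` has length at most `|F t - G t|`; Tonelli compares
  -- the two.
  let B : Set (ℝ × ℝ) :=
    {z | z.2 ∈ Set.Icc a b ∧ min (F z.2) (G z.2) < z.1 ∧ z.1 ≤ max (F z.2) (G z.2)}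
  have hFm : Measurable F := (monotone_cdf _).measurable
  have hGm : Measurable G := (monotone_cdf _).measurable
  have hB : MeasurableSet B := by
    refine (measurableSet_Icc.preimage measurable_snd).inter
      (MeasurableSet.inter (measurableSet_lt (f := fun z : ℝ × ℝ => min (F z.2) (G z.2)) ?_ ?_)
        (measurableSet_le (g := fun z : ℝ × ℝ => max (F z.2) (G z.2)) ?_ ?_)) <;> fun_prop
  calc ∫⁻ u in Set.Ioo (0 : ℝ) 1, edist (quantile μ u) (quantile ν u)
      ≤ ∫⁻ u in Set.Ioo (0 : ℝ) 1, volume (Prod.mk u ⁻¹' B) := by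
        refine setLIntegral_mono' measurableSet_Ioo fun u hu => ?_
        have h1 := quantile_mem_Icc hμ hu
        have h2 := quantile_mem_Icc hν hu
        calc edist (quantile μ u) (quantile ν u)
            = volume (Set.Ico (min (quantile μ u) (quantile ν u))
                (max (quantile μ u) (quantile ν u))) := by
              rw [Real.volume_Ico, max_sub_min_eq_abs', edist_dist, Real.dist_eq]
          _ ≤ volume (Prod.mk u ⁻¹' B) := by
              refine measure_mono fun t ht => ?_
              refine ⟨⟨(le_min h1.1 h2.1).trans ht.1, ht.2.le.trans (max_le h1.2 h2.2)⟩, ?_, ?_⟩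
              · have := ht.2
                rw [lt_max_iff, ← not_le, ← not_le, quantile_le_iff _ hu, quantile_le_iff _ hu,
                  not_le, not_le] at this
                exact min_lt_iff.2 this
              · have := ht.1
                rw [min_le_iff, quantile_le_iff _ hu, quantile_le_iff _ hu] at this
                exact le_max_iff.2 this
    _ ≤ ∫⁻ u, volume (Prod.mk u ⁻¹' B) := setLIntegral_le_lintegral _ _
    _ = ∫⁻ t, volume ((fun u => (u, t)) ⁻¹' B) := by
        rw [← Measure.prod_apply hB, Measure.prod_apply_symm hB]
    _ ≤ ∫⁻ t, (Set.Icc a b).indicator (fun _ => ENNReal.ofReal (cdfDist μ ν)) t := by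
        refine lintegral_mono fun t => ?_
        by_cases ht : t ∈ Set.Icc a b
        · rw [Set.indicator_of_mem ht]
          calc volume ((fun u => (u, t)) ⁻¹' B)
              ≤ volume (Set.Ioc (min (F t) (G t)) (max (F t) (G t))) :=
                measure_mono fun u hu => ⟨hu.2.1, hu.2.2⟩
            _ = ENNReal.ofReal |F t - G t| := by
                rw [Real.volume_Ioc, max_sub_min_eq_abs']
            _ ≤ _ := ENNReal.ofReal_le_ofReal (abs_cdf_sub_le_cdfDist μ ν t)
        · have : (fun u => (u, t)) ⁻¹' B = ∅ := Set.eq_empty_of_forall_notMem fun u hu => ht hu.1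
          simp [this]
    _ = _ := by
        rw [lintegral_indicator measurableSet_Icc, setLIntegral_const, Real.volume_Icc]

/-- On an interval of length at most `D`, `|x - y| ^ p ≤ D ^ (p - 1) * |x - y|`, so the cost of the
quantile coupling reduces to the case `p = 1`. -/
theorem wasserstein_cdfDominated {p : ℝ} (hp : 1 ≤ p) (D : ℝ) :
    CDFDominated (wasserstein p) D 1 1 (1 / p) := by
  intro μ ν a b hab hμ hν
  have hp0 : 0 < p := by linarith
  have hD : 0 ≤ D := by linarith [le_of_measure_compl_Icc_eq_zero hμ]
  have hδ := cdfDist_nonneg μ ν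
  set lam := (volume : Measure ℝ).restrict (Set.Ioo (0 : ℝ) 1) with hlam
  have hQ : AEMeasurable (fun u => (quantile μ u, quantile ν u)) lam :=
    (aemeasurable_quantile μ).prodMk (aemeasurable_quantile ν)
  have hcost : ∫⁻ z, edist z.1 z.2 ^ p ∂(lam.map fun u => (quantile μ u, quantile ν u)) ≤
      ENNReal.ofReal (D ^ p * cdfDist μ ν) := by
    rw [lintegral_map' (by fun_prop) hQ]
    calc ∫⁻ u, edist (quantile μ u) (quantile ν u) ^ p ∂lam
        ≤ ∫⁻ u, ENNReal.ofReal D ^ (p - 1) * edist (quantile μ u) (quantile ν u) ∂lam := by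
          refine setLIntegral_mono' measurableSet_Ioo fun u hu => ?_
          have h1 := quantile_mem_Icc hμ hu
          have h2 := quantile_mem_Icc hν hu
          have hle : edist (quantile μ u) (quantile ν u) ≤ ENNReal.ofReal D := by
            rw [edist_dist, Real.dist_eq]
            exact ENNReal.ofReal_le_ofReal
              (abs_le.2 ⟨by linarith [h1.1, h2.2], by linarith [h1.2, h2.1]⟩)
          calc edist (quantile μ u) (quantile ν u) ^ p
              = edist (quantile μ u) (quantile ν u) ^ (p - 1) *
                  edist (quantile μ u) (quantile ν u) := by
                have h := ENNReal.rpow_add_of_nonneg (x := edist (quantile μ u) (quantile ν u))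
                  (p - 1) 1 (by linarith) zero_le_one
                simpa using h
            _ ≤ _ := by gcongr
      _ = ENNReal.ofReal D ^ (p - 1) * ∫⁻ u, edist (quantile μ u) (quantile ν u) ∂lam :=
          lintegral_const_mul' _ _ (ENNReal.rpow_ne_top_of_nonneg (by linarith) (by simp))
      _ ≤ ENNReal.ofReal D ^ (p - 1) * (ENNReal.ofReal (cdfDist μ ν) * ENNReal.ofReal D) := by
          gcongr
          refine (lintegral_edist_quantile_le hμ hν).trans ?_
          gcongr
      _ = ENNReal.ofReal (D ^ p * cdfDist μ ν) := by
          rw [ENNReal.ofReal_rpow_of_nonneg hD (by linarith), ← ENNReal.ofReal_mul hδ,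
            ← ENNReal.ofReal_mul (by positivity)]
          congr 1
          have : D ^ p = D ^ (p - 1) * D := by
            rw [← Real.rpow_add_one' hD (by linarith)]; simp
          rw [this]; ring
  have hfst : (lam.map fun u => (quantile μ u, quantile ν u)).map Prod.fst = μ := by
    rw [AEMeasurable.map_map_of_aemeasurable measurable_fst.aemeasurable hQ]
    exact map_quantile _
  have hsnd : (lam.map fun u => (quantile μ u, quantile ν u)).map Prod.snd = ν := by
    rw [AEMeasurable.map_map_of_aemeasurable measurable_snd.aemeasurable hQ]
    exact map_quantile _
  calc wasserstein p μ ν ≤ ENNReal.ofReal (D ^ p * cdfDist μ ν) ^ (1 / p) :=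
        ENNReal.rpow_le_rpow (iInf_le_of_le _ (iInf_le_of_le hfst (iInf_le_of_le hsnd hcost)))
          (by positivity)
    _ = _ := by
        rw [ENNReal.ofReal_rpow_of_nonneg (by positivity) (by positivity),
          Real.mul_rpow (by positivity) hδ, ← Real.rpow_mul hD, mul_one_div_cancel hp0.ne']
        simp

/-- Both distribution functions are 0 left of `a` and 1 from `b` on, so the integral lives on `[a,
b]`. -/
theorem cramer_cdfDominated (D : ℝ) : CDFDominated cramer D 1 (1 / 2) 1 := by
  intro μ ν a b hab hμ hν
  have hD : 0 ≤ D := by linarith [le_of_measure_compl_Icc_eq_zero hμ]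
  have hδ := cdfDist_nonneg μ ν
  have hint : ∫⁻ t : ℝ, ENNReal.ofReal (|cdf (μ : Measure ℝ) t - cdf (ν : Measure ℝ) t| ^ 2) ≤
      ENNReal.ofReal (D * cdfDist μ ν ^ 2) := by
    calc _ ≤ ∫⁻ t, (Set.Icc a b).indicator (fun _ => ENNReal.ofReal (cdfDist μ ν ^ 2)) t := by
          refine lintegral_mono fun t => ?_
          by_cases ht : t ∈ Set.Icc a b
          · rw [Set.indicator_of_mem ht]
            gcongr
            exact abs_cdf_sub_le_cdfDist μ ν t
          · rcases lt_or_ge t a with h | h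
            · simp [cdf_eq_zero_of_lt hμ h, cdf_eq_zero_of_lt hν h]
            · have hb : b ≤ t := le_of_not_ge fun hb => ht ⟨h, hb⟩
              simp [cdf_eq_one_of_le hμ hb, cdf_eq_one_of_le hν hb]
      _ = ENNReal.ofReal (cdfDist μ ν ^ 2) * ENNReal.ofReal (b - a) := by
          rw [lintegral_indicator measurableSet_Icc, setLIntegral_const, Real.volume_Icc]
      _ ≤ ENNReal.ofReal (cdfDist μ ν ^ 2) * ENNReal.ofReal D := by gcongr
      _ = _ := by rw [← ENNReal.ofReal_mul (by positivity), mul_comm]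
  calc cramer μ ν ≤ ENNReal.ofReal (D * cdfDist μ ν ^ 2) ^ (1 / 2 : ℝ) :=
        ENNReal.rpow_le_rpow hint (by norm_num)
    _ = _ := by
        rw [ENNReal.ofReal_rpow_of_nonneg (by positivity) (by positivity),
          Real.mul_rpow hD (by positivity), ← Real.sqrt_eq_rpow (cdfDist μ ν ^ 2),
          Real.sqrt_sq hδ, Real.rpow_one, one_mul]

end Dominated

/-! ### Constants and rates -/

section Rates

/-- The explicit bound is of the order `√(d log (n + 1) / n)`. -/
theorem explicit_rate_le {d n : ℕ} (hd : 1 ≤ d) (hn : 1 ≤ n) :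
    √(32 * (d + 1) * Real.log (n + 1) / n) + 4 * √(32 * Real.pi / n) ≤
      72 * √(d * Real.log (n + 1) / n) := by
  have hd' : (1 : ℝ) ≤ d := by exact_mod_cast hd
  have hn' : (1 : ℝ) ≤ n := by exact_mod_cast hn
  have hlog : 1 / 2 ≤ Real.log ((n : ℝ) + 1) := by
    have h1 := Real.log_two_gt_d9
    have h2 := Real.log_le_log (by norm_num) (show (2 : ℝ) ≤ n + 1 by linarith)
    linarith
  -- The constant is `72 = 8 + 4 * 16`: `32 * (d + 1) ≤ 8 ^ 2 * d`, and `32 * π ≤ 128 ≤ 16 ^ 2 * (d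
  -- * log (n + 1))` by this bound.
  have hdl : 1 / 2 ≤ d * Real.log ((n : ℝ) + 1) := by nlinarith
  have h1 : √(32 * (d + 1) * Real.log (n + 1) / n) ≤ 8 * √(d * Real.log (n + 1) / n) := by
    rw [show (8 : ℝ) = √(8 ^ 2) by rw [Real.sqrt_sq]; norm_num, ← Real.sqrt_mul (by norm_num),
      ← mul_div_assoc]
    refine Real.sqrt_le_sqrt (div_le_div_of_nonneg_right ?_ (by positivity))
    nlinarith
  have h2 : √(32 * Real.pi / n) ≤ 16 * √(d * Real.log (n + 1) / n) := by
    rw [show (16 : ℝ) = √(16 ^ 2) by rw [Real.sqrt_sq]; norm_num, ← Real.sqrt_mul (by norm_num),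
      ← mul_div_assoc]
    refine Real.sqrt_le_sqrt (div_le_div_of_nonneg_right ?_ (by positivity))
    nlinarith [Real.pi_le_four]
  linarith

/-- For `n ≥ 2`, `n + 1 ≤ n ^ 2`. -/
theorem sqrt_log_succ_le {d n : ℕ} (hn : 2 ≤ n) :
    √(d * Real.log (n + 1) / n) ≤ 2 * √(d * Real.log n / n) := by
  have hn' : (2 : ℝ) ≤ n := by exact_mod_cast hn
  have hlog : Real.log ((n : ℝ) + 1) ≤ 2 * Real.log n := by
    rw [← Nat.cast_ofNat (R := ℝ), ← Real.log_pow]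
    exact Real.log_le_log (by positivity) (by nlinarith)
  have hlog0 : 0 ≤ Real.log (n : ℝ) := Real.log_nonneg (by linarith)
  rw [show (2 : ℝ) = √(2 ^ 2) by rw [Real.sqrt_sq]; norm_num, ← Real.sqrt_mul (by norm_num),
    ← mul_div_assoc]
  refine Real.sqrt_le_sqrt (div_le_div_of_nonneg_right ?_ (by positivity))
  have : (0 : ℝ) ≤ d := Nat.cast_nonneg d
  nlinarith [mul_le_mul_of_nonneg_left hlog this, mul_nonneg this hlog0]

theorem explicit_rate_rpow_le {d n : ℕ} (hd : 1 ≤ d) (hn : 1 ≤ n) {L α D β : ℝ} (hL : 0 < L)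
    (hα : 0 < α) (hD : 0 ≤ D) :
    L * D ^ β * (√(32 * (d + 1) * Real.log (n + 1) / n) + 4 * √(32 * Real.pi / n)) ^ α ≤
      L * 144 ^ α * D ^ β * √(d * Real.log (n + 1) / n) ^ α := by
  -- Here 72 would do; `144 = 2 * 72` also absorbs the passage from `log (n + 1)` to `log n`, so one
  -- constant serves both bounds.
  calc _ ≤ L * D ^ β * (144 * √(d * Real.log (n + 1) / n)) ^ α := by
        gcongr
        refine (explicit_rate_le hd hn).trans ?_
        gcongr
        norm_num
    _ = _ := by rw [Real.mul_rpow (by norm_num) (by positivity)]; ring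

/-- The term with `π` is pure slack: the first square root already suffices. -/
theorem expectedError_le_explicit {d n : ℕ} [NeZero n] {L α D β : ℝ} (hL : 0 < L) (hα : 0 < α)
    (hα1 : α ≤ 1) (hD : 0 ≤ D) {Δ : ProbabilityMeasure ℝ → ProbabilityMeasure ℝ → ℝ≥0∞}
    {P : ProbabilityMeasure (EuclideanSpace ℝ (Fin d))} {Ω : Type*} [MeasurableSpace Ω]
    {ρ : Measure Ω} [IsProbabilityMeasure ρ] {X : Fin n → Ω → EuclideanSpace ℝ (Fin d)}
    (hP : SuppDiamLE P D) (hΔ : CDFDominated Δ D L β α) (hX : IsIIDSample X P ρ) :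
    expectedError Δ ρ X P ≤ ENNReal.ofReal (L * D ^ β *
      (√(32 * (d + 1) * Real.log (n + 1) / n) + 4 * √(32 * Real.pi / n)) ^ α) := by
  refine (expectedError_le hL hα hα1 hD hP hΔ hX).trans (ENNReal.ofReal_le_ofReal ?_)
  gcongr
  linarith [Real.sqrt_nonneg (32 * Real.pi / n)]

theorem expectedError_le_log {d n : ℕ} [NeZero n] {L α D β : ℝ} (hd : 1 ≤ d) (hn : 2 ≤ n)
    (hL : 0 < L) (hα : 0 < α) (hα1 : α ≤ 1) (hD : 0 ≤ D)
    {Δ : ProbabilityMeasure ℝ → ProbabilityMeasure ℝ → ℝ≥0∞}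
    {P : ProbabilityMeasure (EuclideanSpace ℝ (Fin d))} {Ω : Type*} [MeasurableSpace Ω]
    {ρ : Measure Ω} [IsProbabilityMeasure ρ] {X : Fin n → Ω → EuclideanSpace ℝ (Fin d)}
    (hP : SuppDiamLE P D) (hΔ : CDFDominated Δ D L β α) (hX : IsIIDSample X P ρ) :
    expectedError Δ ρ X P ≤
      ENNReal.ofReal (L * 144 ^ α * D ^ β * (d * Real.log n / n) ^ (α / 2)) := by
  refine (expectedError_le_explicit hL hα hα1 hD hP hΔ hX).trans (ENNReal.ofReal_le_ofReal ?_)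
  have hlog0 : 0 ≤ Real.log (n : ℝ) := Real.log_natCast_nonneg n
  calc _ ≤ L * D ^ β * (144 * √(d * Real.log n / n)) ^ α := by
        gcongr
        refine (explicit_rate_le hd (by omega)).trans ?_
        linarith [sqrt_log_succ_le (d := d) hn]
    _ = _ := by
        rw [Real.mul_rpow (by norm_num) (by positivity), Real.sqrt_eq_rpow,
          ← Real.rpow_mul (by positivity), show 1 / 2 * α = α / 2 by ring]
        ring

end Rates

end MaxSlicing

/-! ### The sample complexity theorem -/

theorem proposition4 :
    -- the general bound; the constant depends on `L` and `α` only
    (∀ L α : ℝ, 0 < L → 0 < α → α ≤ 1 → ∃ C : ℝ, 0 < C ∧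
      ∀ (d n : ℕ) [NeZero n] (D β : ℝ)
        (Δ : ProbabilityMeasure ℝ → ProbabilityMeasure ℝ → ℝ≥0∞)
        (P : ProbabilityMeasure (EuclideanSpace ℝ (Fin d)))
        (Ω : Type u) [MeasurableSpace Ω] (ρ : Measure Ω) [IsProbabilityMeasure ρ]
        (X : Fin n → Ω → EuclideanSpace ℝ (Fin d)),
        1 ≤ d → 0 ≤ D → 0 ≤ β →
        MaxSlicing.SuppDiamLE P D → MaxSlicing.CDFDominated Δ D L β α →
        MaxSlicing.IsIIDSample X P ρ →
        MaxSlicing.expectedError Δ ρ X P ≤ ENNReal.ofReal (L * D ^ β *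
            (√(32 * (d + 1) * Real.log (n + 1) / n) + 4 * √(32 * Real.pi / n)) ^ α) ∧
        L * D ^ β * (√(32 * (d + 1) * Real.log (n + 1) / n) + 4 * √(32 * Real.pi / n)) ^ α ≤
          C * D ^ β * (√(d * Real.log (n + 1) / n)) ^ α ∧
        (2 ≤ n → MaxSlicing.expectedError Δ ρ X P ≤
          ENNReal.ofReal (C * D ^ β * (d * Real.log n / n) ^ (α / 2)))) ∧
    -- max-sliced `W₁`
    (∃ C : ℝ, 0 < C ∧
      ∀ (d n : ℕ) [NeZero n] (D : ℝ) (P : ProbabilityMeasure (EuclideanSpace ℝ (Fin d)))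
        (Ω : Type u) [MeasurableSpace Ω] (ρ : Measure Ω) [IsProbabilityMeasure ρ]
        (X : Fin n → Ω → EuclideanSpace ℝ (Fin d)),
        1 ≤ d → 2 ≤ n → 0 ≤ D → MaxSlicing.SuppDiamLE P D → MaxSlicing.IsIIDSample X P ρ →
        MaxSlicing.expectedError (MaxSlicing.wasserstein 1) ρ X P ≤
          ENNReal.ofReal (C * (D * √(d * Real.log n / n)))) ∧
    -- max-sliced `W_p`, `p > 1`
    (∀ p : ℝ, 1 < p → ∃ C : ℝ, 0 < C ∧
      ∀ (d n : ℕ) [NeZero n] (D : ℝ) (P : ProbabilityMeasure (EuclideanSpace ℝ (Fin d)))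
        (Ω : Type u) [MeasurableSpace Ω] (ρ : Measure Ω) [IsProbabilityMeasure ρ]
        (X : Fin n → Ω → EuclideanSpace ℝ (Fin d)),
        1 ≤ d → 2 ≤ n → 0 ≤ D → MaxSlicing.SuppDiamLE P D → MaxSlicing.IsIIDSample X P ρ →
        MaxSlicing.expectedError (MaxSlicing.wasserstein p) ρ X P ≤
          ENNReal.ofReal (C * (D * (d * Real.log n / n) ^ (1 / (2 * p))))) ∧
    -- max-sliced Cramér
    (∃ C : ℝ, 0 < C ∧
      ∀ (d n : ℕ) [NeZero n] (D : ℝ) (P : ProbabilityMeasure (EuclideanSpace ℝ (Fin d)))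
        (Ω : Type u) [MeasurableSpace Ω] (ρ : Measure Ω) [IsProbabilityMeasure ρ]
        (X : Fin n → Ω → EuclideanSpace ℝ (Fin d)),
        1 ≤ d → 2 ≤ n → 0 ≤ D → MaxSlicing.SuppDiamLE P D → MaxSlicing.IsIIDSample X P ρ →
        MaxSlicing.expectedError MaxSlicing.cramer ρ X P ≤
          ENNReal.ofReal (C * (√D * √(d * Real.log n / n)))) := by
  -- All constants are `L * 144 ^ α`, with `L = 1` and `α = 1`, `1 / p`, `1` for `W₁`, `W_p` and
  -- Cramér.
  refine ⟨fun L α hL hα hα1 => ⟨L * 144 ^ α, by positivity, ?_⟩, ⟨144, by norm_num, ?_⟩,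
    fun p hp => ⟨144 ^ (1 / p), by positivity, ?_⟩, ⟨144, by norm_num, ?_⟩⟩
  · intro d n _ D β Δ P Ω _ ρ _ X hd hD _ hP hΔ hX
    exact ⟨MaxSlicing.expectedError_le_explicit hL hα hα1 hD hP hΔ hX,
      MaxSlicing.explicit_rate_rpow_le hd (NeZero.pos n) hL hα hD,
      fun hn => MaxSlicing.expectedError_le_log hd hn hL hα hα1 hD hP hΔ hX⟩
  · intro d n _ D P Ω _ ρ _ X hd hn hD hP hX
    have h := MaxSlicing.expectedError_le_log hd hn one_pos (by norm_num) (by norm_num) hD hP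
      (MaxSlicing.wasserstein_cdfDominated le_rfl D) hX
    rw [div_one, ← Real.sqrt_eq_rpow, Real.rpow_one, Real.rpow_one, one_mul, mul_assoc] at h
    exact h
  · intro d n _ D P Ω _ ρ _ X hd hn hD hP hX
    have hp0 : 0 < p := by linarith
    have h := MaxSlicing.expectedError_le_log hd hn one_pos (by positivity)
      ((div_le_one hp0).2 hp.le) hD hP (MaxSlicing.wasserstein_cdfDominated hp.le D) hX
    rw [Real.rpow_one, one_mul, mul_assoc, show 1 / p / 2 = 1 / (2 * p) by
      rw [div_div, mul_comm]] at h
    exact h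
  · intro d n _ D P Ω _ ρ _ X hd hn hD hP hX
    have h := MaxSlicing.expectedError_le_log hd hn one_pos one_pos le_rfl hD hP
      (MaxSlicing.cramer_cdfDominated D) hX
    rw [← Real.sqrt_eq_rpow, ← Real.sqrt_eq_rpow, Real.rpow_one, one_mul, mul_assoc] at h
    exact h
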